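/- Let $\Omega\subset\mathbb C$ be a bounded finitely connected region, let $z_0\in\Omega$, and let $m$ be the harmonic measure on $\partial\Omega$ for the point $z_0$. For a complex Banach space $E$, let $H^\infty(\Omega,E)$ denote the space of bounded analytic functions $\Omega\to E$, and put $H^\infty(\Omega)=H^\infty(\Omega,\mathbb C)$. Let $K$ and $K'$ be complex Hilbert spaces with $\dim K=\dim K'=n<\infty$, and let $L(K,K')$ be the space of bounded linear operators from $K$ to $K'$. A function $\varphi\in H^\infty(\Omega,L(K,K'))$ is called quasi-inner if there is a constant $c>0$ such that, for $m$-almost every $\zeta\in\partial\Omega$ and every $k\in K$, $\|\varphi(\zeta)k\|\ge c\|k\|$ holds in the sense of nontangential boundary values, that is, $$\liminf_{z\to\zeta\ \text{nontangentially}}\|\varphi(z)k\|\ \ge\ c\,\|k\| .$$ (Where $\varphi$ has a nontangential limit $\varphi(\zeta)$, this says exactly that $\|\varphi(\zeta)k\|\ge c\|k\|$ for every $k\in K$.) Let $\varphi\in H^\infty(\Omega,L(K,K'))$ be quasi-inner, let $\psi\in H^\infty(\Omega,L(K',K))$, and let $u\in H^\infty(\Omega)$ be not identically zero. If $$\varphi(z)\psi(z)=u(z)I_{K'}\qquad\text{for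 all } z\in\Omega,$$ then $$\psi(z)\varphi(z)=u(z)I_{K}\qquad\text{for all } z\in\Omega .$$ -/

import Mathlib

open Filter Topology MeasureTheory
open scoped ENNReal

noncomputable section

/-- A bounded finitely connected region in the plane: a bounded, nonempty, connected open set
whose complement in the Riemann sphere has finitely many connected components. -/
structure IsBoundedFinitelyConnectedRegion (Ω : Set ℂ) : Prop where
  isOpen : IsOpen Ω
  isConnected : IsConnected Ω
  isBounded : Bornology.IsBounded Ω
  finite_components :
    Finite (ConnectedComponents (((fun z : ℂ => (z : OnePoint ℂ)) '' Ω)ᶜ : Set (OnePoint ℂ)))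

/-- `f` belongs to `H^∞(Ω, E)`: it is analytic and bounded on `Ω`.  Only the values of `f` on `Ω`
matter.  The scalar space `H^∞(Ω)` is the case `E = ℂ`. -/
structure MemHInf {E : Type*} [NormedAddCommGroup E] [NormedSpace ℂ E]
    (Ω : Set ℂ) (f : ℂ → E) : Prop where
  analytic : AnalyticOnNhd ℂ f Ω
  bounded : ∃ C : ℝ, ∀ z ∈ Ω, ‖f z‖ ≤ C

/-- Nonnegative superharmonic functions on `Ω` with values in `[0, ∞]`: lower semicontinuous, with
`(1 / 2π) ∫ s(z + r e^{iθ}) dθ ≤ s(z)` for every closed disc in `Ω`.  (The constant `∞` is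
included; it never affects an infimum.) -/
structure IsNonnegSuperharmonicOn (Ω : Set ℂ) (s : ℂ → ℝ≥0∞) : Prop where
  lsc : LowerSemicontinuousOn s Ω
  mean_le : ∀ z ∈ Ω, ∀ r : ℝ, 0 < r → Metric.closedBall z r ⊆ Ω →
    ∫⁻ θ in Set.Ioc 0 (2 * Real.pi), s (circleMap z r θ) ≤ ENNReal.ofReal (2 * Real.pi) * s z

/-- The upper Perron class of the indicator function of `E ∩ ∂Ω`: nonnegative superharmonic
functions on `Ω` whose lower limit at each point of `E ∩ ∂Ω` is at least `1`. -/
def upperPerronClass (Ω E : Set ℂ) : Set (ℂ → ℝ≥0∞) :=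
  {s | IsNonnegSuperharmonicOn Ω s ∧ ∀ ζ ∈ E ∩ frontier Ω, 1 ≤ liminf s (𝓝[Ω] ζ)}

theorem upperPerronClass_anti {Ω E F : Set ℂ} (h : E ⊆ F) :
    upperPerronClass Ω F ⊆ upperPerronClass Ω E :=
  fun _ hs => ⟨hs.1, fun ζ hζ => hs.2 ζ ⟨h hζ.1, hζ.2⟩⟩

theorem zero_mem_upperPerronClass (Ω : Set ℂ) :
    (fun _ => 0 : ℂ → ℝ≥0∞) ∈ upperPerronClass Ω ∅ :=
  ⟨⟨fun _ _ => continuousWithinAt_const.lowerSemicontinuousWithinAt, by simp⟩, by simp⟩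

theorem tsum_mem_upperPerronClass {Ω : Set ℂ} {E : ℕ → Set ℂ} {s : ℕ → ℂ → ℝ≥0∞}
    (hs : ∀ i, s i ∈ upperPerronClass Ω (E i)) :
    (fun z => ∑' i, s i z) ∈ upperPerronClass Ω (⋃ i, E i) := by
  refine ⟨⟨lowerSemicontinuousOn_tsum fun i => (hs i).1.lsc, ?_⟩, ?_⟩
  · intro z hz r hr hball
    have hm : ∀ i, Measurable fun θ => s i (circleMap z r θ) := by
      intro i
      have h1 : LowerSemicontinuousOn (fun θ => s i (circleMap z r θ)) Set.univ :=
        LowerSemicontinuousOn.comp (hs i).1.lsc (continuous_circleMap z r).continuousOn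
          fun θ _ => hball (circleMap_mem_closedBall z hr.le θ)
      exact (lowerSemicontinuousOn_univ_iff.1 h1).measurable
    rw [lintegral_tsum fun i => (hm i).aemeasurable, ← ENNReal.tsum_mul_left]
    exact ENNReal.tsum_le_tsum fun i => (hs i).1.mean_le z hz r hr hball
  · rintro ζ ⟨hζ, hζ'⟩
    obtain ⟨i, hi⟩ := Set.mem_iUnion.1 hζ
    refine ((hs i).2 ζ ⟨hi, hζ'⟩).trans (liminf_le_liminf (Eventually.of_forall fun z => ?_))
    exact ENNReal.le_tsum i

/-- Harmonic measure for the point `z₀` of the bounded region `Ω`, as an outer measure: the value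
at `E` is the upper Perron solution, at `z₀`, of the Dirichlet problem on `Ω` with boundary data
the indicator function of `E ∩ ∂Ω`. -/
def harmonicMeasure (Ω : Set ℂ) (z₀ : ℂ) : OuterMeasure ℂ where
  measureOf E := ⨅ s ∈ upperPerronClass Ω E, s z₀
  empty := le_antisymm (iInf₂_le _ (zero_mem_upperPerronClass Ω)) bot_le
  mono h := biInf_mono (upperPerronClass_anti h)
  iUnion_nat E _ := by
    refine ENNReal.le_of_forall_pos_le_add fun ε hε hfin => ?_
    obtain ⟨δ, hδ, hδε⟩ := ENNReal.exists_pos_sum_of_countable (ENNReal.coe_pos.2 hε).ne' ℕ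
    have key : ∀ i, ∃ s ∈ upperPerronClass Ω (E i),
        s z₀ < (⨅ s ∈ upperPerronClass Ω (E i), s z₀) + δ i := by
      intro i
      have hlt : (⨅ s ∈ upperPerronClass Ω (E i), s z₀) <
          (⨅ s ∈ upperPerronClass Ω (E i), s z₀) + δ i :=
        ENNReal.lt_add_right (ne_top_of_le_ne_top hfin.ne (ENNReal.le_tsum i))
          (ENNReal.coe_pos.2 (hδ i)).ne'
      obtain ⟨s, hs⟩ := iInf_lt_iff.1 hlt
      obtain ⟨hs', hs⟩ := iInf_lt_iff.1 hs
      exact ⟨s, hs', hs⟩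
    choose s hs hs' using key
    calc (⨅ t ∈ upperPerronClass Ω (⋃ i, E i), t z₀) ≤ ∑' i, s i z₀ :=
          iInf₂_le (fun z => ∑' i, s i z) (tsum_mem_upperPerronClass hs)
      _ ≤ ∑' i, ((⨅ s ∈ upperPerronClass Ω (E i), s z₀) + δ i) :=
          ENNReal.tsum_le_tsum fun i => (hs' i).le
      _ = (∑' i, ⨅ s ∈ upperPerronClass Ω (E i), s z₀) + ∑' i, (δ i : ℝ≥0∞) := ENNReal.tsum_add
      _ ≤ _ := by gcongr

/-- The nontangential approach region at `ζ ∈ ∂Ω` with aperture `a`: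
the points `z ∈ Ω` with `|z - ζ| < a · dist(z, ∂Ω)`. -/
def approachRegion (Ω : Set ℂ) (ζ : ℂ) (a : ℝ) : Set ℂ :=
  {z ∈ Ω | dist z ζ < a * Metric.infDist z (frontier Ω)}

/-- The filter "`z → ζ` nontangentially from within `Ω`": `Tendsto f (nontangential Ω ζ) l` says
that `f` tends to `l` at `ζ` within every nontangential approach region. -/
def nontangential (Ω : Set ℂ) (ζ : ℂ) : Filter ℂ :=
  ⨆ a : ℝ, ⨆ _ : 1 < a, 𝓝[approachRegion Ω ζ a] ζ

/-- Boundedness below on the boundary: there is `c > 0` such that for almost every `ζ ∈ ∂Ω` with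
respect to harmonic measure, and every `k`, the boundary values of `z ↦ ‖φ(z) k‖` at `ζ` are at
least `c ‖k‖`.  These are taken as nontangential lower limits, so that nothing is presupposed about
the boundary of `Ω`; where `φ` has a nontangential limit `A` at `ζ`, this says that
`c ‖k‖ ≤ ‖A k‖` (see `le_liminf_nontangential_iff`). -/
def IsQuasiInner {K K' : Type*} [NormedAddCommGroup K] [NormedSpace ℂ K]
    [NormedAddCommGroup K'] [NormedSpace ℂ K']
    (Ω : Set ℂ) (z₀ : ℂ) (φ : ℂ → K →L[ℂ] K') : Prop :=
  ∃ c : ℝ, 0 < c ∧ ∀ᵐ ζ ∂(harmonicMeasure Ω z₀), ζ ∈ frontier Ω → ∀ k : K,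
    ENNReal.ofReal (c * ‖k‖) ≤ liminf (fun z => ENNReal.ofReal ‖φ z k‖) (nontangential Ω ζ)

/-- Where the nontangential (strong) limit `A` of `φ` at `ζ` exists, the pointwise condition in
`IsQuasiInner` is a lower bound for the boundary value `A`. -/
theorem le_liminf_nontangential_iff {K K' : Type*} [NormedAddCommGroup K] [NormedSpace ℂ K]
    [NormedAddCommGroup K'] [NormedSpace ℂ K'] {Ω : Set ℂ} {ζ : ℂ} {φ : ℂ → K →L[ℂ] K'}
    {A : K →L[ℂ] K'} [(nontangential Ω ζ).NeBot] {k : K}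
    (h : Tendsto (fun z => φ z k) (nontangential Ω ζ) (𝓝 (A k))) (c : ℝ) :
    ENNReal.ofReal (c * ‖k‖) ≤ liminf (fun z => ENNReal.ofReal ‖φ z k‖) (nontangential Ω ζ) ↔
      c * ‖k‖ ≤ ‖A k‖ := by
  rw [(ENNReal.tendsto_ofReal h.norm).liminf_eq, ENNReal.ofReal_le_ofReal_iff (norm_nonneg _)]

end

/-! Where `u z ≠ 0`, the identity `φ z ∘ ψ z = u z • id` makes `φ z` surjective. As `K` and `K'`
have the same finite dimension, `φ z` is then invertible with inverse `(u z)⁻¹ • ψ z`, so the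
factors may be exchanged; this is `comp_eq_smul_id_comm_of_finrank_eq`. At zeros of `u` this
argument says nothing, but both sides of the desired identity are analytic on the connected set `Ω`,
so agreement near one point with `u ≠ 0` spreads to all of `Ω`. -/

/-- Between finite-dimensional spaces of equal dimension, a right inverse up to a nonzero scalar is
a left inverse up to the same scalar. -/
theorem comp_eq_smul_id_comm_of_finrank_eq {𝕜 V W : Type*} [NontriviallyNormedField 𝕜]
    [NormedAddCommGroup V] [NormedSpace 𝕜 V] [FiniteDimensional 𝕜 V]
    [NormedAddCommGroup W] [NormedSpace 𝕜 W] [FiniteDimensional 𝕜 W]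
    (hVW : Module.finrank 𝕜 V = Module.finrank 𝕜 W) {A : V →L[𝕜] W} {B : W →L[𝕜] V} {c : 𝕜}
    (hc : c ≠ 0) (h : A.comp B = c • ContinuousLinearMap.id 𝕜 W) :
    B.comp A = c • ContinuousLinearMap.id 𝕜 V := by
  have hAB : ∀ w, A (B w) = c • w := fun w => by simpa using DFunLike.congr_fun h w
  have hsurj : Function.Surjective (A : V →ₗ[𝕜] W) := fun w =>
    ⟨B (c⁻¹ • w), by simp [hAB, smul_smul, hc]⟩
  have hinj : Function.Injective (A : V →ₗ[𝕜] W) :=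
    (LinearMap.injective_iff_surjective_of_finrank_eq_finrank hVW).2 hsurj
  ext v
  -- Cancelling the injective `A` reduces the goal to `A (B (A v)) = c • A v`, which is `hAB` at `A
  -- v`.
  apply hinj
  simp [hAB]

theorem corollary3p3
    {K K' : Type*}
    [NormedAddCommGroup K] [InnerProductSpace ℂ K] [FiniteDimensional ℂ K]
    [NormedAddCommGroup K'] [InnerProductSpace ℂ K'] [FiniteDimensional ℂ K']
    (n : ℕ) (hK : Module.finrank ℂ K = n) (hK' : Module.finrank ℂ K' = n)
    (Ω : Set ℂ) (hΩ : IsBoundedFinitelyConnectedRegion Ω)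
    (z₀ : ℂ) (hz₀ : z₀ ∈ Ω)
    (φ : ℂ → K →L[ℂ] K') (hφ : MemHInf Ω φ) (hφq : IsQuasiInner Ω z₀ φ)
    (ψ : ℂ → K' →L[ℂ] K) (hψ : MemHInf Ω ψ)
    (u : ℂ → ℂ) (hu : MemHInf Ω u) (hu0 : ∃ z ∈ Ω, u z ≠ 0)
    (hφψ : ∀ z ∈ Ω, (φ z).comp (ψ z) = u z • ContinuousLinearMap.id ℂ K') :
    ∀ z ∈ Ω, (ψ z).comp (φ z) = u z • ContinuousLinearMap.id ℂ K := by
  obtain ⟨w, hw, huw⟩ := hu0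
  -- Composition of operators is a continuous bilinear map, hence analytic in the pair.
  have hleft : AnalyticOnNhd ℂ (fun z => (ψ z).comp (φ z)) Ω := fun z hz =>
    ((ContinuousLinearMap.compL ℂ K K' K).analyticAt_bilinear (ψ z, φ z)).comp₂
      (hψ.analytic z hz) (hφ.analytic z hz)
  have hright : AnalyticOnNhd ℂ (fun z => u z • ContinuousLinearMap.id ℂ K) Ω := fun z hz =>
    (hu.analytic z hz).smul analyticAt_const
  -- By the identity theorem it suffices to compare the two sides near a point where `u ≠ 0`.
  refine hleft.eqOn_of_preconnected_of_eventuallyEq hright hΩ.isConnected.isPreconnected hw ?_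
  -- By continuity, `u` stays nonzero near `w`, so the pointwise algebra applies on a whole
  -- neighbourhood.
  filter_upwards [hΩ.isOpen.mem_nhds hw,
    (hu.analytic w hw).continuousAt.eventually_ne huw] with z hz huz
  exact comp_eq_smul_id_comm_of_finrank_eq (hK.trans hK'.symm) huz (hφψ z hz)
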